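/- Let $N$ be a positive integer, $\alpha\in\mathbb{Z}/N\mathbb{Z}$, and let $\mathcal{P}(N;\alpha)$ be the set of prime numbers $p$ with $p\equiv\alpha \pmod N$. For a commutative ring $R$ put $$\mathcal{A}_{n}:=\Bigl(\prod_{p\in\mathcal{P}(N;\alpha)}R/p^{n}R\Bigr)\Big/\Bigl(\bigoplus_{p\in\mathcal{P}(N;\alpha)}R/p^{n}R\Bigr)\quad(n\ge 1),\qquad \widehat{\mathcal{A}}^{\mathcal{P}(N;\alpha)}_{R}:=\varprojlim_{n}\mathcal{A}_{n},$$ with the projective limit topology, each $\mathcal{A}_n$ being discrete; this is a $\mathbb{Q}$-algebra. Let $\pi\colon\prod_{p}\varprojlim_{n}R/p^{n}R\to\widehat{\mathcal{A}}^{\mathcal{P}(N;\alpha)}_{R}$ be the natural projection, and put $\boldsymbol{p}:=\pi((p)_{p})$ and $a^{\boldsymbol{p}}:=\pi((a^{p})_{p})$ for $a\in R$. For $a_1,\dots,a_m\in R$ and positive integers $k_1,\dots,k_m$ define the $\boldsymbol{p}$-adic finite multiple polylogarithm $$\pounds_{\widehat{\mathcal{A}},\alpha}\binom{a_1,\dots,a_m}{k_1,\dots,k_m}:=\pi\Biggl(\Bigl(\sum_{0<n_1<\cdots<n_m<p}\frac{a_1^{n_1}a_2^{n_2-n_1}\cdots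 a_m^{n_m-n_{m-1}}}{n_1^{k_1}\cdots n_m^{k_m}}\Bigr)_{p\in\mathcal{P}(N;\alpha)}\Biggr)\in\widehat{\mathcal{A}}^{\mathcal{P}(N;\alpha)}_{R}.$$ Let $r\ge 0$, $s\ge 1$, let $x_1,\dots,x_r,y_1,\dots,y_s$ be indeterminates, $k_1,\dots,k_r,l_1,\dots,l_s$ positive integers, and $R=\mathbb{Z}[x_1,\dots,x_r,y_1,y_1^{-1},y_2,\dots,y_s]$. On the $\mathbb{Q}$-vector space with basis the formal tuples $\binom{a_1,\dots,a_m}{h_1,\dots,h_m}$ ($m\ge 0$, $a_i\in\{1,x_1,\dots,x_r,y_1,\dots,y_s\}$, $h_i\ge 1$), let $\sqcup\!\sqcup$ be the product obtained by identifying such a tuple with the word $e_{a_1}e_0^{h_1-1}\cdots e_{a_m}e_0^{h_m-1}$ in the noncommutative polynomial ring over $\mathbb{Q}$ in the letters $e_z$, $z\in\{0,1,x_1,\dots,x_r,y_1,\dots,y_s\}$, and taking the shuffle product of words (the $\mathbb{Q}$-bilinear product with $1\,\sqcup\!\sqcup\,w=w\,\sqcup\!\sqcup\,1=w$ and $we_z\,\sqcup\!\sqcup\,w'e_{z'}=(we_z\,\sqcup\!\sqcup\,w')e_{z'}+(w\,\sqcup\!\sqcup\,w'e_{z'})e_z$).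 Extend $\pounds_{\widehat{\mathcal{A}},\alpha}$ $\mathbb{Q}$-linearly to this space. Then the series below converges (unconditionally) and $$\pounds_{\widehat{\mathcal{A}},\alpha}\left(\binom{x_1,\dots,x_r}{k_1,\dots,k_r}\,\sqcup\!\sqcup\,\binom{y_1,\dots,y_s}{l_1,\dots,l_s}\right)=(-1)^{l_1+\cdots+l_s}\,y_1^{\boldsymbol{p}}\sum_{f_1,\dots,f_s\ge 0}\left(\prod_{i=1}^{s}\binom{l_i+f_i-1}{f_i}\right)\pounds_{\widehat{\mathcal{A}},\alpha}\binom{x_1/y_1,\dots,x_r/y_1,\,1/y_1,\,y_s/y_1,\dots,y_2/y_1}{k_1,\dots,k_r,\,l_s+f_s,\dots,l_1+f_1}\,\boldsymbol{p}^{f_1+\cdots+f_s}$$ holds in $\widehat{\mathcal{A}}^{\mathcal{P}(N;\alpha)}_{R}$. (The factors $\binom{l_i+f_i-1}{f_i}$ in the product are binomial coefficients.) -/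

import Mathlib

/-! ### Tuples, words and the shuffle product

`A` is the set of nonzero letters; the letters are `Option A`, with `none` playing the role of the
letter `0`. -/

namespace PShuffle

/-- The noncommutative polynomial ring `ℚ⟨e_z | z ∈ {0} ∪ A⟩`. -/
abbrev Words (A : Type*) := FreeAlgebra ℚ (Option A)

/-- The letter `e_z`. -/
abbrev e {A : Type*} (z : Option A) : Words A := FreeAlgebra.ι ℚ z

/-- The basis of `Words A` consisting of the words. -/
noncomputable def wordBasis (A : Type*) : Module.Basis (List (Option A)) ℚ (Words A) :=
  FreeAlgebra.basisFreeMonoid ℚ (Option A)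

theorem wordBasis_apply {A : Type*} (u : List (Option A)) :
    wordBasis A u = (u.map e).prod := by
  change (FreeAlgebra.equivMonoidAlgebraFreeMonoid (R := ℚ) (X := Option A)).symm
    (MonoidAlgebra.single (FreeMonoid.ofList u) 1) = _
  rw [AlgEquiv.symm_apply_eq, map_list_prod, List.map_map]
  induction u with
  | nil => simp [MonoidAlgebra.one_def]
  | cons a u ih =>
    rw [List.map_cons, List.prod_cons, ← ih]
    simp [FreeAlgebra.equivMonoidAlgebraFreeMonoid, MonoidAlgebra.single_mul_single]

/-- Shuffle product of two words, each written from its last letter to its first one. -/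
noncomputable def shuffleRev {A : Type*} : List (Option A) → List (Option A) → Words A
  | [], v => (v.reverse.map e).prod
  | z :: u, [] => ((z :: u).reverse.map e).prod
  | z :: u, z' :: v => shuffleRev (z :: u) v * e z' + shuffleRev u (z' :: v) * e z
termination_by u v => u.length + v.length

/-- The `ℚ`-bilinear shuffle product on `Words A`. -/
noncomputable def shuffle {A : Type*} : Words A →ₗ[ℚ] Words A →ₗ[ℚ] Words A :=
  (wordBasis A).constr ℚ fun u => (wordBasis A).constr ℚ fun v => shuffleRev u.reverse v.reverse

/-- The `ℚ`-vector space spanned by the tuples `(a₁, …, a_r; k₁, …, k_r)` with `a_i ∈ A` and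
`k_i` positive integers. -/
abbrev Tuples (A : Type*) := List (A × ℕ+) →₀ ℚ

/-- The linear injection `W` that sends `(a₁, …, a_r; k₁, …, k_r)` to
`e_{a₁} e₀^{k₁-1} ⋯ e_{a_r} e₀^{k_r-1}`. -/
noncomputable def W {A : Type*} : Tuples A →ₗ[ℚ] Words A :=
  Finsupp.linearCombination ℚ fun t : List (A × ℕ+) =>
    (t.map fun c => e (some c.1) * e none ^ ((c.2 : ℕ) - 1)).prod

/-- Reads a word from the right; the first entry counts the pending letters `e₀`. -/
def decodeAux {A : Type*} : List (Option A) → ℕ × List (A × ℕ+)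
  | [] => (0, [])
  | none :: u => ((decodeAux u).1 + 1, (decodeAux u).2)
  | some a :: u => (0, (a, (decodeAux u).1.succPNat) :: (decodeAux u).2)

/-- The inverse of `W` on the span of the words that are empty or do not begin with `e₀`. -/
noncomputable def WInv {A : Type*} : Words A →ₗ[ℚ] Tuples A :=
  (wordBasis A).constr ℚ fun u => Finsupp.single (decodeAux u).2 1

/-- The shuffle product of tuples, `W⁻¹ (W a ⧢ W b)`. -/
noncomputable def tupleShuffle {A : Type*} (a b : Tuples A) : Tuples A :=
  WInv (shuffle (W a) (W b))

/-! The next facts, up to `W_tupleShuffle`, show that `tupleShuffle` is well defined: `WInv` is a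
left inverse of `W`, and `W` carries `tupleShuffle` to `shuffle`. -/

/-- The word of a tuple, as a list of letters. -/
def encode {A : Type*} (t : List (A × ℕ+)) : List (Option A) :=
  t.flatMap fun c => some c.1 :: List.replicate ((c.2 : ℕ) - 1) none

theorem W_single {A : Type*} (t : List (A × ℕ+)) :
    W (Finsupp.single t 1) = wordBasis A (encode t) := by
  rw [wordBasis_apply, W, Finsupp.linearCombination_single, one_smul]
  induction t with
  | nil => simp [encode]
  | cons c t ih => simp_all [encode, mul_assoc]

theorem decodeAux_replicate {A : Type*} (n : ℕ) (u : List (Option A)) :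
    decodeAux (List.replicate n none ++ u) = ((decodeAux u).1 + n, (decodeAux u).2) := by
  induction n with
  | zero => simp
  | succ n ih => simp [List.replicate_succ, decodeAux, ih, add_assoc]

theorem decodeAux_encode {A : Type*} (t : List (A × ℕ+)) : decodeAux (encode t) = (0, t) := by
  induction t with
  | nil => simp [encode, decodeAux]
  | cons c t ih =>
    have : encode (c :: t) = some c.1 :: (List.replicate ((c.2 : ℕ) - 1) none ++ encode t) := by
      simp [encode]
    rw [this, decodeAux, decodeAux_replicate, ih]
    have h : ((c.2 : ℕ) - 1).succPNat = c.2 := PNat.eq (Nat.sub_add_cancel c.2.pos)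
    simp [h]

theorem encode_decodeAux {A : Type*} (u : List (Option A)) :
    List.replicate (decodeAux u).1 none ++ encode (decodeAux u).2 = u := by
  induction u with
  | nil => simp [encode, decodeAux]
  | cons z u ih =>
    cases z with
    | none => simpa [decodeAux, List.replicate_succ] using ih
    | some a => simpa [decodeAux, encode] using ih

theorem encode_decodeAux_of_head {A : Type*} (u : List (Option A)) (h : u.head? ≠ some none) :
    encode (decodeAux u).2 = u := by
  have := encode_decodeAux u
  match u, h with
  | [], _ => rfl
  | some a :: u, _ => simpa [decodeAux] using this

theorem WInv_W {A : Type*} (a : Tuples A) : WInv (W a) = a := by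
  induction a using Finsupp.induction_linear with
  | zero => simp
  | add f g hf hg => simp [hf, hg]
  | single t c =>
    rw [← mul_one c, ← smul_eq_mul, ← Finsupp.smul_single, map_smul, map_smul, W_single, WInv,
      Module.Basis.constr_basis, decodeAux_encode]

theorem shuffle_basis {A : Type*} (u v : List (Option A)) :
    shuffle (wordBasis A u) (wordBasis A v) = shuffleRev u.reverse v.reverse := by
  simp [shuffle]

theorem shuffleRev_mem {A : Type*} : ∀ u v : List (Option A),
    u.reverse.head? ≠ some none → v.reverse.head? ≠ some none →
    shuffleRev u v ∈ Submodule.span ℚ (wordBasis A ''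
      {w | w.head? ≠ some none ∧ w.length = u.length + v.length})
  | [], v, _, hv => by
    rw [shuffleRev, ← wordBasis_apply]
    exact Submodule.subset_span ⟨_, ⟨hv, by simp⟩, rfl⟩
  | z :: u, [], hu, _ => by
    rw [shuffleRev, ← wordBasis_apply]
    exact Submodule.subset_span ⟨_, ⟨hu, by simp⟩, rfl⟩
  | z :: u, z' :: v, hu, hv => by
    have tail : ∀ (x : Option A) (w : List (Option A)),
        (x :: w).reverse.head? ≠ some none → w.reverse.head? ≠ some none := by
      intro x w h h'
      apply h
      rw [List.reverse_cons, List.head?_append, h']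
      rfl
    have step : ∀ (x : Option A) (n : ℕ) (W : Words A),
        W ∈ Submodule.span ℚ (wordBasis A '' {w | w.head? ≠ some none ∧ w.length = n + 1}) →
        W * e x ∈ Submodule.span ℚ
          (wordBasis A '' {w | w.head? ≠ some none ∧ w.length = n + 2}) := by
      intro x n W hW
      induction hW using Submodule.span_induction with
      | zero => simp
      | add a b _ _ ha hb => rw [add_mul]; exact Submodule.add_mem _ ha hb
      | smul c a _ ha => rw [smul_mul_assoc]; exact Submodule.smul_mem _ _ ha
      | mem a ha =>
        obtain ⟨w, ⟨h1, h2⟩, rfl⟩ := ha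
        refine Submodule.subset_span ⟨w ++ [x], ⟨?_, by simp [h2]⟩, ?_⟩
        · cases w with
          | nil => simp at h2
          | cons b w => simpa using h1
        · simp [wordBasis_apply]
    rw [shuffleRev]
    have e1 : (z :: u).length + (z' :: v).length = (u.length + v.length) + 2 := by
      simp; omega
    rw [e1]
    refine Submodule.add_mem _ (step _ _ _ ?_) (step _ _ _ ?_)
    · have := shuffleRev_mem (z :: u) v hu (tail _ _ hv)
      rwa [show (z :: u).length + v.length = u.length + v.length + 1 by simp; omega] at this
    · have := shuffleRev_mem u (z' :: v) (tail _ _ hu) hv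
      rwa [show u.length + (z' :: v).length = u.length + v.length + 1 by simp; omega] at this
termination_by u v => u.length + v.length

theorem W_WInv_basis {A : Type*} (u : List (Option A)) (h : u.head? ≠ some none) :
    W (WInv (wordBasis A u)) = wordBasis A u := by
  rw [WInv, Module.Basis.constr_basis, W_single, encode_decodeAux_of_head u h]

theorem encode_head {A : Type*} (t : List (A × ℕ+)) : (encode t).head? ≠ some none := by
  cases t <;> simp [encode]

theorem W_tupleShuffle {A : Type*} (a b : Tuples A) :
    W (tupleShuffle a b) = shuffle (W a) (W b) := by
  have lin : (LinearMap.compr₂ (shuffle.compl₁₂ W W) (W ∘ₗ WInv) :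
      Tuples A →ₗ[ℚ] Tuples A →ₗ[ℚ] Words A) = shuffle.compl₁₂ W W := by
    refine Finsupp.lhom_ext' fun t => LinearMap.ext_ring ?_
    refine Finsupp.lhom_ext' fun t' => LinearMap.ext_ring ?_
    simp only [LinearMap.comp_apply, Finsupp.lsingle_apply, LinearMap.compr₂_apply,
      LinearMap.compl₁₂_apply, W_single, shuffle_basis]
    have := shuffleRev_mem (encode t).reverse (encode t').reverse
      (by simpa using encode_head t) (by simpa using encode_head t')
    refine LinearMap.eqOn_span (f := W ∘ₗ WInv) (g := LinearMap.id) ?_ this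
    rintro _ ⟨w, hw, rfl⟩
    exact W_WInv_basis w hw.1
  exact LinearMap.congr_fun₂ lin a b

/-! The defining recursion of the shuffle product. -/

theorem one_shuffle {A : Type*} (w : Words A) : shuffle 1 w = w := by
  have h1 : (1 : Words A) = wordBasis A [] := by simp [wordBasis_apply]
  have : shuffle (1 : Words A) = LinearMap.id := by
    refine (wordBasis A).ext fun u => ?_
    rw [h1, shuffle_basis, List.reverse_nil, shuffleRev, List.reverse_reverse,
      ← wordBasis_apply, LinearMap.id_apply]
  rw [this, LinearMap.id_apply]

theorem shuffle_one {A : Type*} (w : Words A) : shuffle w 1 = w := by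
  have h1 : (1 : Words A) = wordBasis A [] := by simp [wordBasis_apply]
  have : shuffle.flip (1 : Words A) = LinearMap.id := by
    refine (wordBasis A).ext fun u => ?_
    rw [h1, LinearMap.flip_apply, shuffle_basis, LinearMap.id_apply, List.reverse_nil,
      wordBasis_apply]
    conv_rhs => rw [← List.reverse_reverse u]
    cases u.reverse <;> rw [shuffleRev]
  exact LinearMap.congr_fun this w

theorem shuffle_mul_letter {A : Type*} (w w' : Words A) (z z' : Option A) :
    shuffle (w * e z) (w' * e z') =
      shuffle (w * e z) w' * e z' + shuffle w (w' * e z') * e z := by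
  have snoc : ∀ (u : List (Option A)) (x : Option A),
      LinearMap.mulRight ℚ (e x) (wordBasis A u) = wordBasis A (u ++ [x]) := by
    intro u x
    simp [wordBasis_apply]
  have lin : (shuffle.compl₁₂ (LinearMap.mulRight ℚ (e z)) (LinearMap.mulRight ℚ (e z')) :
      Words A →ₗ[ℚ] Words A →ₗ[ℚ] Words A) =
      (shuffle.compl₁₂ (LinearMap.mulRight ℚ (e z)) LinearMap.id).compr₂
        (LinearMap.mulRight ℚ (e z')) +
      (shuffle.compl₁₂ LinearMap.id (LinearMap.mulRight ℚ (e z'))).compr₂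
        (LinearMap.mulRight ℚ (e z)) := by
    refine (wordBasis A).ext fun u => (wordBasis A).ext fun v => ?_
    simp only [LinearMap.add_apply, LinearMap.compr₂_apply, LinearMap.compl₁₂_apply, snoc,
      LinearMap.id_apply, shuffle_basis, List.reverse_append, List.reverse_singleton,
      List.singleton_append, LinearMap.mulRight_apply]
    rw [shuffleRev]
  exact LinearMap.congr_fun₂ lin w w'

/-! ### The adelic ring -/

section Adelic

variable {ι R : Type*} [CommRing R] (σ : ι → R)

/-- The ideal `⨁ R/aⁿR` of `∏ R/aⁿR`, where `a` runs through the family `σ`. -/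
def finSuppIdeal (n : ℕ) : Ideal (∀ i, R ⧸ Ideal.span {σ i} ^ n) where
  carrier := {f | {i | f i ≠ 0}.Finite}
  zero_mem' := by simp
  add_mem' {f g} hf hg := (Set.Finite.union hf hg).subset fun i hi => by
    by_contra h
    simp only [Set.mem_union, Set.mem_ofPred_eq, not_or, not_not] at h
    exact hi (by simp [h.1, h.2])
  smul_mem' c f hf := Set.Finite.subset hf fun i hi h => hi (by simp [h])

/-- `𝒜ₙ = (∏ R/aⁿR) / (⨁ R/aⁿR)`. -/
abbrev AdelicLevel (n : ℕ) := (∀ i, R ⧸ Ideal.span {σ i} ^ n) ⧸ finSuppIdeal σ n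

/-- The natural projection `∏ R/aⁿR → ∏ R/aᵐR`. -/
def piTransition {m n : ℕ} (h : m ≤ n) :
    (∀ i, R ⧸ Ideal.span {σ i} ^ n) →+* (∀ i, R ⧸ Ideal.span {σ i} ^ m) :=
  RingHom.pi fun i => (Ideal.Quotient.factorPow (Ideal.span {σ i}) h).comp (Pi.evalRingHom _ i)

theorem finSuppIdeal_le_comap {m n : ℕ} (h : m ≤ n) :
    finSuppIdeal σ n ≤ (finSuppIdeal σ m).comap (piTransition σ h) := fun f hf =>
  Set.Finite.subset hf fun i hi h0 => hi (by
    change Ideal.Quotient.factorPow (Ideal.span {σ i}) h (f i) = 0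
    rw [h0, map_zero])

/-- The natural projection `𝒜ₙ → 𝒜ₘ`. -/
def adelicTransition {m n : ℕ} (h : m ≤ n) : AdelicLevel σ n →+* AdelicLevel σ m :=
  Ideal.quotientMap _ (piTransition σ h) (finSuppIdeal_le_comap σ h)

/-- The compatible sequences in `∏_{n ≥ 1} 𝒜ₙ`. -/
def adelicSubring : Subring (∀ n : ℕ+, AdelicLevel σ n) where
  carrier := {f | ∀ m n : ℕ+, ∀ h : m ≤ n,
    adelicTransition σ (PNat.coe_le_coe m n |>.2 h) (f n) = f m}
  mul_mem' hf hg m n h := by simp [hf m n h, hg m n h]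
  one_mem' m n h := by simp
  add_mem' hf hg m n h := by simp [hf m n h, hg m n h]
  zero_mem' m n h := by simp
  neg_mem' hf m n h := by simp [hf m n h]

/-- The adelic ring `𝒜̂ = lim 𝒜ₙ`. -/
def Adelic : Type _ := adelicSubring σ

noncomputable instance : CommRing (Adelic σ) := inferInstanceAs (CommRing (adelicSubring σ))

/-- The projective limit topology, each `𝒜ₙ` being discrete. -/
instance : TopologicalSpace (Adelic σ) :=
  TopologicalSpace.induced (fun f : Adelic σ => f.1)
    (@Pi.topologicalSpace ℕ+ (fun n => AdelicLevel σ n) fun _ => ⊥)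

/-- The natural projection `π : ∏ lim R/aⁿR → 𝒜̂`. -/
noncomputable def adelicProj :
    (∀ i, AdicCompletion (Ideal.span {σ i}) R) →+* Adelic σ :=
  RingHom.codRestrict
    (RingHom.pi fun n : ℕ+ => (Ideal.Quotient.mk (finSuppIdeal σ n)).comp
      (RingHom.pi fun i => ((AdicCompletion.evalₐ (Ideal.span {σ i}) n).toRingHom).comp
        (Pi.evalRingHom _ i)))
    (adelicSubring σ) fun f m n h => by
      refine congrArg (Ideal.Quotient.mk (finSuppIdeal σ m)) (funext fun i => ?_)
      change Ideal.Quotient.factorPow _ (PNat.coe_le_coe m n |>.2 h)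
        (AdicCompletion.evalₐ (Ideal.span {σ i}) n (f i)) = AdicCompletion.evalₐ _ m (f i)
      induction f i using AdicCompletion.induction_on with
      | h c =>
        rw [AdicCompletion.evalₐ_mk, AdicCompletion.evalₐ_mk, Ideal.Quotient.factor_mk]
        have hc := c.property (PNat.coe_le_coe m n |>.2 h)
        rw [SModEq.sub_mem] at hc
        rw [Ideal.Quotient.eq, ← neg_sub, neg_mem_iff]
        simpa using hc

end Adelic

/-! ### Finite multiple polylogarithms -/

/-- `∑_{m < n₁ < ⋯ < n_r < M} a₁^{n₁-m} a₂^{n₂-n₁} ⋯ a_r^{n_r-n_{r-1}} / (n₁^{k₁} ⋯ n_r^{k_r})`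
in a commutative ring in which `1, …, M - 1` are invertible. -/
noncomputable def mplFrom {S : Type*} [CommRing S] (M : ℕ) : ℕ → List (S × ℕ) → S
  | _, [] => 1
  | m, (a, k) :: t =>
      ∑ n ∈ Finset.Ioo m M, a ^ (n - m) * Ring.inverse ((n : S) ^ k) * mplFrom M n t

/-- `£_{<M}(a₁, …, a_r; k₁, …, k_r) = ∑_{0 < n₁ < ⋯ < n_r < M}
a₁^{n₁} a₂^{n₂-n₁} ⋯ a_r^{n_r-n_{r-1}} / (n₁^{k₁} ⋯ n_r^{k_r})`. -/
noncomputable def mplTrunc {S : Type*} [CommRing S] (M : ℕ) (t : List (S × ℕ)) : S :=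
  mplFrom M 0 t

/-- The primes congruent to `α` modulo `N`. -/
abbrev PrimesMod (N : ℕ) (α : ZMod N) := {p : ℕ // p.Prime ∧ (p : ZMod N) = α}

section FMPL

variable (N : ℕ) (α : ZMod N) (R : Type*) [CommRing R]

/-- The adelic ring of `R` for the family of the primes congruent to `α` modulo `N`. -/
abbrev AHat := Adelic (fun p : PrimesMod N α => ((p : ℕ) : R))

theorem isUnit_intCast_level (m : ℤ) (hm : m ≠ 0) (n : ℕ) :
    IsUnit (m : AdelicLevel (fun p : PrimesMod N α => ((p : ℕ) : R)) n) := by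
  have key : ∀ p : PrimesMod N α, ¬ ((p : ℕ) : ℤ) ∣ m →
      IsUnit (m : R ⧸ Ideal.span {((p : ℕ) : R)} ^ n) := by
    intro p hp
    have hc : IsCoprime m (((p : ℕ) : ℤ) ^ n) :=
      (((Nat.prime_iff_prime_int.1 p.2.1).coprime_iff_not_dvd.2 hp).symm).pow_right
    obtain ⟨a, b, hab⟩ := hc
    refine IsUnit.of_mul_eq_one (a : R ⧸ Ideal.span {((p : ℕ) : R)} ^ n) ?_
    have h0 : (((p : ℕ) : R ⧸ Ideal.span {((p : ℕ) : R)} ^ n)) ^ n = 0 := by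
      rw [← map_natCast (Ideal.Quotient.mk (Ideal.span {((p : ℕ) : R)} ^ n)), ← map_pow,
        Ideal.Quotient.eq_zero_iff_mem]
      exact Ideal.pow_mem_pow (Ideal.mem_span_singleton_self _) n
    have := congrArg (Int.cast : ℤ → R ⧸ Ideal.span {((p : ℕ) : R)} ^ n) hab
    push_cast at this
    rw [h0] at this
    rw [mul_comm]
    simpa using this
  refine IsUnit.of_mul_eq_one (Ideal.Quotient.mk _ fun p => Ring.inverse (m : R ⧸ _)) ?_
  rw [← map_intCast (Ideal.Quotient.mk (finSuppIdeal _ n)), ← map_mul,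
    ← map_one (Ideal.Quotient.mk (finSuppIdeal _ n)), Ideal.Quotient.eq]
  have hfin : {p : PrimesMod N α | ((p : ℕ) : ℤ) ∣ m}.Finite := by
    refine Set.Finite.of_finite_image (f := fun p : PrimesMod N α => (p : ℕ))
      ((Set.finite_le_nat m.natAbs).subset ?_) Subtype.val_injective.injOn
    rintro _ ⟨p, hp, rfl⟩
    exact Nat.le_of_dvd (Int.natAbs_pos.2 hm) (Int.natCast_dvd.1 hp)
  refine hfin.subset fun p hp => ?_
  by_contra h
  refine hp ?_
  change (m : R ⧸ Ideal.span {((p : ℕ) : R)} ^ n) * Ring.inverse (m : R ⧸ _) - 1 = 0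
  rw [Ring.mul_inverse_cancel _ (key p h), sub_self]

theorem isUnit_intCast_AHat (m : ℤ) (hm : m ≠ 0) : IsUnit (m : AHat N α R) := by
  have hu := fun n : ℕ+ => isUnit_intCast_level N α R m hm n
  choose u hu using fun n : ℕ+ => (hu n).exists_right_inv
  refine IsUnit.of_mul_eq_one (⟨u, fun a b h => ?_⟩ : adelicSubring _) ?_
  · have h1 := congrArg (adelicTransition _ (PNat.coe_le_coe a b |>.2 h)) (hu b)
    rw [map_mul, map_intCast, map_one] at h1
    calc _ = (m * u a) * adelicTransition _ (PNat.coe_le_coe a b |>.2 h) (u b) := by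
          rw [hu a, one_mul]
      _ = u a * (m * adelicTransition _ (PNat.coe_le_coe a b |>.2 h) (u b)) := by ring
      _ = u a := by rw [h1, mul_one]
  · exact Subtype.ext (funext fun n => hu n)

/-- `AHat N α R` is a `ℚ`-algebra. -/
noncomputable instance : Algebra ℚ (AHat N α R) :=
  (IsLocalization.lift (M := nonZeroDivisors ℤ) (S := ℚ) (g := Int.castRingHom (AHat N α R))
    fun m => isUnit_intCast_AHat N α R m (nonZeroDivisors.ne_zero m.2)).toAlgebra

/-- The infinitely large prime `𝐩`, the class of `(p)_p`. -/
noncomputable def bigP : AHat N α R := adelicProj _ fun p => ((p : ℕ) : AdicCompletion _ R)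

variable {R}

/-- The power `a^𝐩`, the class of `(a^p)_p`. -/
noncomputable def powP (a : R) : AHat N α R :=
  adelicProj _ fun p => algebraMap R (AdicCompletion _ R) a ^ (p : ℕ)

/-- The `𝐩`-adic finite multiple polylogarithm `£_{𝒜̂,α}(a₁, …, a_r; k₁, …, k_r)`, the class of
`(£_{<p}(a₁, …, a_r; k₁, …, k_r))_p`. The integers `1, …, p - 1` are invertible in
`lim R/pⁿR`. -/
noncomputable def fmpl (t : List (R × ℕ)) : AHat N α R :=
  adelicProj _ fun p =>
    mplTrunc (p : ℕ) (t.map fun c => (algebraMap R (AdicCompletion _ R) c.1, c.2))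

/-- The `ℚ`-linear extension of `£_{𝒜̂,α}` to formal tuples, the symbol `a : A` standing for the
element `val a` of `R`. -/
noncomputable def fmplLin {A : Type*} (val : A → R) : Tuples A →ₗ[ℚ] AHat N α R :=
  Finsupp.linearCombination ℚ fun t => fmpl N α (t.map fun c => (val c.1, (c.2 : ℕ)))

end FMPL

/-! ### The variables -/

/-- `ℤ[x₁, …, x_r, y₁, y₁⁻¹, y₂, …, y_{s+1}]`. -/
abbrev LaurentRing (r s : ℕ) :=
  Localization.Away (MvPolynomial.X (Sum.inr 0) : MvPolynomial (Fin r ⊕ Fin (s + 1)) ℤ)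

/-- The variable `x_i`. -/
noncomputable def xv {r s : ℕ} (i : Fin r) : LaurentRing r s :=
  algebraMap (MvPolynomial (Fin r ⊕ Fin (s + 1)) ℤ) _ (MvPolynomial.X (Sum.inl i))

/-- The variable `y_j`. -/
noncomputable def yv {r s : ℕ} (j : Fin (s + 1)) : LaurentRing r s :=
  algebraMap (MvPolynomial (Fin r ⊕ Fin (s + 1)) ℤ) _ (MvPolynomial.X (Sum.inr j))

/-- The element `y₁⁻¹`. -/
noncomputable def y1inv {r s : ℕ} : LaurentRing r s :=
  IsLocalization.Away.invSelf
    (MvPolynomial.X (Sum.inr 0) : MvPolynomial (Fin r ⊕ Fin (s + 1)) ℤ)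

/-- The symbols `1` (that is `none`), `x_i` and `y_j`. -/
abbrev Symb (r s : ℕ) := Option (Fin r ⊕ Fin (s + 1))

/-- The element of the ring denoted by a symbol. -/
noncomputable def symbVal {r s : ℕ} : Symb r s → LaurentRing r s
  | none => 1
  | some (Sum.inl i) => xv i
  | some (Sum.inr j) => yv j

/-- The tuple `(x₁, …, x_r; k₁, …, k_r)`. -/
noncomputable def xTuple {r s : ℕ} (k : Fin r → ℕ+) : Tuples (Symb r s) :=
  Finsupp.single (List.ofFn fun i => (some (Sum.inl i), k i)) 1

/-- The tuple `(y₁, …, y_{s+1}; l₁, …, l_{s+1})`. -/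
noncomputable def yTuple {r s : ℕ} (l : Fin (s + 1) → ℕ+) : Tuples (Symb r s) :=
  Finsupp.single (List.ofFn fun j => (some (Sum.inr j), l j)) 1

/-- The tuple with first row `x₁/y₁, …, x_r/y₁, 1/y₁, y_{s+1}/y₁, …, y₂/y₁` and second row
`k₁, …, k_r, l_{s+1} + f_{s+1}, …, l₁ + f₁`. -/
noncomputable def reversedTuple {r s : ℕ} (k : Fin r → ℕ+) (l : Fin (s + 1) → ℕ+)
    (f : Fin (s + 1) → ℕ) : List (LaurentRing r s × ℕ) :=
  List.zip
    ((List.ofFn fun i => xv i * y1inv) ++ y1inv ::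
      (List.ofFn fun j : Fin s => yv j.succ * y1inv).reverse)
    ((List.ofFn fun i => (k i : ℕ)) ++ (List.ofFn fun j => (l j : ℕ) + f j).reverse)

end PShuffle

open PShuffle

namespace PShuffle

open PowerSeries Finset

section Series

variable {S : Type*} [CommRing S]

/-- The inverse of `n` if `n < M`, and `0` otherwise. -/
noncomputable def truncInv (S : Type*) [CommRing S] (M n : ℕ) : S :=
  if n < M then Ring.inverse (n : S) else 0

theorem truncInv_zero (M : ℕ) : truncInv S M 0 = 0 := by
  simp [truncInv]

theorem truncInv_of_le {M n : ℕ} (h : M ≤ n) : truncInv S M n = 0 := by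
  simp [truncInv, h]

theorem mul_truncInv {M n : ℕ} (h : n < M) (hu : IsUnit (n : S)) :
    (n : S) * truncInv S M n = 1 := by
  rw [truncInv, if_pos h, Ring.mul_inverse_cancel _ hu]

theorem inverse_natCast_pow {M n : ℕ} (h : n < M) (k : ℕ) :
    Ring.inverse ((n : S) ^ k) = truncInv S M n ^ k := by
  rw [truncInv, if_pos h, Ring.inverse_pow]

/-- The power series `∑_{j ≥ 1} aʲ Xʲ`. -/
noncomputable def geomTail (a : S) : S⟦X⟧ := PowerSeries.mk fun j => if j = 0 then 0 else a ^ j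

theorem coeff_geomTail_mul (a : S) (F : S⟦X⟧) (n : ℕ) :
    coeff n (geomTail a * F) = ∑ m ∈ range n, a ^ (n - m) * coeff m F := by
  rw [mul_comm, coeff_mul, Nat.sum_antidiagonal_eq_sum_range_succ_mk, sum_range_succ]
  simp only [geomTail, coeff_mk, Nat.sub_self, if_true, mul_zero, add_zero]
  refine sum_congr rfl fun m hm => ?_
  rw [if_neg (by have := mem_range.1 hm; omega), mul_comm]

/-- Multiplication by a kernel `K`, followed by multiplication of the coefficients by weights. -/
noncomputable def weightedMul (w : ℕ → S) (K F : S⟦X⟧) : S⟦X⟧ :=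
  PowerSeries.mk fun n => w n * coeff n (K * F)

theorem coeff_weightedMul (w : ℕ → S) (K F : S⟦X⟧) (n : ℕ) :
    coeff n (weightedMul w K F) = w n * coeff n (K * F) := by
  rw [weightedMul, coeff_mk]

/-- The kernel of a letter. -/
noncomputable def letterKernel {A : Type*} (val : A → S) : Option A → S⟦X⟧
  | none => 1
  | some a => geomTail (val a)

/-- The generating series of the iterated sums attached to a word written from its last letter
to its first one. -/
noncomputable def wordSeries {A : Type*} (M : ℕ) (val : A → S) : List (Option A) → S⟦X⟧
  | [] => 1
  | z :: u => weightedMul (truncInv S M) (letterKernel val z) (wordSeries M val u)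

theorem coeff_zero_wordSeries_cons {A : Type*} (M : ℕ) (val : A → S) (z : Option A)
    (u : List (Option A)) : coeff 0 (wordSeries M val (z :: u)) = 0 := by
  rw [wordSeries, coeff_weightedMul, truncInv_zero, zero_mul]

theorem natCast_mul_coeff_wordSeries {A : Type*} {M : ℕ}
    (hM : ∀ n : ℕ, 0 < n → n < M → IsUnit (n : S)) (val : A → S) (z : Option A)
    (u : List (Option A)) (n : ℕ) (hn : 0 < n) (hnM : n < M) :
    (n : S) * coeff n (wordSeries M val (z :: u)) =
      coeff n (letterKernel val z * wordSeries M val u) := by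
  rw [wordSeries, coeff_weightedMul, ← mul_assoc, mul_truncInv hnM (hM n hn hnM), one_mul]

theorem natCast_mul_coeff_wordSeries_of_getLast? {A : Type*} {M : ℕ}
    (hM : ∀ n : ℕ, 0 < n → n < M → IsUnit (n : S)) (val : A → S) (z : Option A)
    (u : List (Option A)) (hu : (z :: u).getLast? ≠ some none) (n : ℕ) (hnM : n < M) :
    (n : S) * coeff n (wordSeries M val (z :: u)) =
      coeff n (letterKernel val z * wordSeries M val u) := by
  rcases Nat.eq_zero_or_pos n with rfl | hn
  · cases z with
    | some a => simp [letterKernel, coeff_geomTail_mul]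
    | none =>
      cases u with
      | nil => simp at hu
      | cons b u =>
        rw [letterKernel, one_mul, coeff_zero_wordSeries_cons, coeff_zero_wordSeries_cons,
          mul_zero]
  · exact natCast_mul_coeff_wordSeries hM val z u n hn hnM

theorem coeff_mul_congr {M : ℕ} {F G : S⟦X⟧} (h : ∀ n < M, coeff n F = coeff n G) (K : S⟦X⟧)
    (n : ℕ) (hn : n < M) : coeff n (K * F) = coeff n (K * G) := by
  rw [coeff_mul, coeff_mul]
  refine sum_congr rfl fun x hx => ?_
  have := mem_antidiagonal.1 hx
  rw [h x.2 (by omega)]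

theorem natCast_mul_coeff_mul {M : ℕ} {F G F' G' : S⟦X⟧}
    (hF : ∀ n < M, (n : S) * coeff n F = coeff n F')
    (hG : ∀ n < M, (n : S) * coeff n G = coeff n G') (n : ℕ) (hn : n < M) :
    (n : S) * coeff n (F * G) = coeff n (F' * G) + coeff n (F * G') := by
  simp only [coeff_mul, mul_sum, ← sum_add_distrib]
  refine sum_congr rfl fun x hx => ?_
  have hx := mem_antidiagonal.1 hx
  rw [← hF x.1 (by omega), ← hG x.2 (by omega), ← hx]
  push_cast
  ring

end Series

/-- The list of the shuffles of two words, all of them written from their last letter to their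
first one. -/
def shuffleWords {B : Type*} : List B → List B → List (List B)
  | [], v => [v]
  | z :: u, [] => [z :: u]
  | z :: u, z' :: v =>
      (shuffleWords (z :: u) v).map (z' :: ·) ++ (shuffleWords u (z' :: v)).map (z :: ·)
termination_by u v => u.length + v.length

theorem shuffleRev_eq_sum {A : Type*} : ∀ u v : List (Option A),
    shuffleRev u v = ((shuffleWords u v).map fun w => wordBasis A w.reverse).sum
  | [], v => by simp [shuffleRev, shuffleWords, wordBasis_apply]
  | z :: u, [] => by simp [shuffleRev, shuffleWords, wordBasis_apply]
  | z :: u, z' :: v => by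
    have snoc : ∀ (x : Option A) (l : List (List (Option A))),
        (l.map fun w => wordBasis A w.reverse).sum * e x =
          ((l.map (x :: ·)).map fun w => wordBasis A w.reverse).sum := by
      intro x l
      rw [← List.sum_map_mul_right, List.map_map]
      congr 1
      refine List.map_congr_left fun w _ => ?_
      simp [wordBasis_apply]
    rw [shuffleRev, shuffleWords, shuffleRev_eq_sum (z :: u) v, shuffleRev_eq_sum u (z' :: v),
      List.map_append, List.sum_append, snoc, snoc]
termination_by u v => u.length + v.length

theorem getLast?_of_cons {B : Type*} {z b : B} {u : List B}
    (h : (z :: u).getLast? ≠ some b) : u.getLast? ≠ some b := by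
  cases u with
  | nil => simp
  | cons c u => simpa using h

theorem getLast?_shuffleWords {B : Type*} {b : B} : ∀ u v : List B,
    u.getLast? ≠ some b → v.getLast? ≠ some b → ∀ w ∈ shuffleWords u v,
    w.getLast? ≠ some b ∧ w.length = u.length + v.length
  | [], v, _, hv, w, hw => by simp_all [shuffleWords]
  | z :: u, [], hu, _, w, hw => by simp_all [shuffleWords]
  | z :: u, z' :: v, hu, hv, w, hw => by
    have aux : ∀ (x : B) (w : List B), w.getLast? ≠ some b → 0 < w.length →
        (x :: w).getLast? ≠ some b := by
      intro x w hw h0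
      cases w with
      | nil => simp at h0
      | cons c w => simpa using hw
    rw [shuffleWords, List.mem_append, List.mem_map, List.mem_map] at hw
    rcases hw with ⟨w, hw, rfl⟩ | ⟨w, hw, rfl⟩
    · obtain ⟨h1, h2⟩ := getLast?_shuffleWords (z :: u) v hu (getLast?_of_cons hv) w hw
      exact ⟨aux _ _ h1 (by simp at h2; omega), by simp at h2 ⊢; omega⟩
    · obtain ⟨h1, h2⟩ := getLast?_shuffleWords u (z' :: v) (getLast?_of_cons hu) hv w hw
      exact ⟨aux _ _ h1 (by simp at h2; omega), by simp at h2 ⊢; omega⟩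
termination_by u v => u.length + v.length

section ShuffleSeries

variable {S : Type*} [CommRing S]

/-- The generating series turn the shuffle product into the product. -/
theorem coeff_sum_wordSeries_shuffleWords {A : Type*} {M : ℕ}
    (hM : ∀ n : ℕ, 0 < n → n < M → IsUnit (n : S)) (val : A → S) : ∀ u v : List (Option A),
    u.getLast? ≠ some none → v.getLast? ≠ some none → ∀ n < M,
    coeff n ((shuffleWords u v).map (wordSeries M val)).sum =
      coeff n (wordSeries M val u * wordSeries M val v)
  | [], v, _, _, n, _ => by simp [shuffleWords, wordSeries]
  | z :: u, [], _, _, n, _ => by simp [shuffleWords, wordSeries]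
  | z :: u, z' :: v, hu, hv, n, hn => by
    have cons0 : ∀ (x : Option A) (l : List (List (Option A))),
        coeff 0 ((l.map (x :: ·)).map (wordSeries M val)).sum = 0 := by
      intro x l
      rw [map_list_sum, List.map_map, List.map_map]
      refine List.sum_eq_zero fun y hy => ?_
      obtain ⟨w, -, rfl⟩ := List.mem_map.1 hy
      exact coeff_zero_wordSeries_cons M val x w
    have cons1 : ∀ (x : Option A) (l : List (List (Option A))), 0 < n →
        (n : S) * coeff n ((l.map (x :: ·)).map (wordSeries M val)).sum =
          coeff n (letterKernel val x * (l.map (wordSeries M val)).sum) := by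
      intro x l h0
      induction l with
      | nil => simp
      | cons w l ih =>
        simp only [List.map_cons, List.sum_cons, map_add, mul_add] at ih ⊢
        rw [ih, natCast_mul_coeff_wordSeries hM val x w n h0 hn]
    rw [shuffleWords, List.map_append, List.sum_append, map_add]
    rcases Nat.eq_zero_or_pos n with rfl | h0
    · rw [cons0, cons0, coeff_mul, Finset.Nat.antidiagonal_zero, sum_singleton,
        coeff_zero_wordSeries_cons, zero_mul, add_zero]
    · refine (hM n h0 hn).mul_left_cancel ?_
      rw [mul_add, cons1 _ _ h0, cons1 _ _ h0,
        natCast_mul_coeff_mul (natCast_mul_coeff_wordSeries_of_getLast? hM val z u hu)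
          (natCast_mul_coeff_wordSeries_of_getLast? hM val z' v hv) n hn,
        coeff_mul_congr (coeff_sum_wordSeries_shuffleWords hM val (z :: u) v hu
          (getLast?_of_cons hv)) _ n hn,
        coeff_mul_congr (coeff_sum_wordSeries_shuffleWords hM val u (z' :: v)
          (getLast?_of_cons hu) hv) _ n hn, add_comm]
      congr 2 <;> ring
termination_by u v => u.length + v.length

/-- The operator on generating series that appends an entry to a tuple. -/
noncomputable def appendEntry (M : ℕ) (F : S⟦X⟧) (c : S × ℕ) : S⟦X⟧ :=
  weightedMul (fun n => truncInv S M n ^ c.2) (geomTail c.1) F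

theorem sum_coeff_foldl_appendEntry (M : ℕ) (t : List (S × ℕ)) (F : S⟦X⟧) :
    ∑ n ∈ range M, coeff n (t.foldl (appendEntry M) F) =
      ∑ m ∈ range M, coeff m F * mplFrom M m t := by
  induction t generalizing F with
  | nil => simp [mplFrom]
  | cons c t ih =>
    obtain ⟨a, k⟩ := c
    rw [List.foldl_cons, ih]
    simp only [mplFrom, appendEntry, coeff_weightedMul, coeff_geomTail_mul, mul_sum, sum_mul]
    rw [sum_sigma', sum_sigma']
    refine sum_bij' (fun x _ => ⟨x.2, x.1⟩) (fun x _ => ⟨x.2, x.1⟩) ?_ ?_ ?_ ?_ ?_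
    · rintro ⟨n, m⟩ h
      simp only [mem_sigma, mem_range, mem_Ioo] at h ⊢
      omega
    · rintro ⟨n, m⟩ h
      simp only [mem_sigma, mem_range, mem_Ioo] at h ⊢
      omega
    · rintro ⟨n, m⟩ h; rfl
    · rintro ⟨n, m⟩ h; rfl
    · rintro ⟨n, m⟩ h
      simp only [mem_sigma, mem_range] at h
      rw [inverse_natCast_pow h.1]
      ring

theorem mplTrunc_eq_sum_coeff {M : ℕ} (hM : 0 < M) (t : List (S × ℕ)) :
    mplTrunc M t = ∑ n ∈ range M, coeff n (t.foldl (appendEntry M) 1) := by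
  rw [sum_coeff_foldl_appendEntry, sum_eq_single_of_mem 0 (mem_range.2 hM)]
  · simp [mplTrunc]
  · intro n _ hn
    simp [coeff_one, hn]

theorem wordSeries_replicate_none {A : Type*} (M : ℕ) (val : A → S) (a : A) (j : ℕ)
    (u : List (Option A)) :
    wordSeries M val (List.replicate j none ++ some a :: u) =
      appendEntry M (wordSeries M val u) (val a, j + 1) := by
  induction j with
  | zero => simp [wordSeries, appendEntry, letterKernel]
  | succ j ih =>
    rw [List.replicate_succ, List.cons_append, wordSeries, ih, letterKernel]
    ext n
    simp only [appendEntry, coeff_weightedMul, one_mul]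
    ring

theorem wordSeries_encode {A : Type*} (M : ℕ) (val : A → S) (t : List (A × ℕ+)) :
    wordSeries M val (encode t).reverse =
      (t.map fun c => (val c.1, (c.2 : ℕ))).foldl (appendEntry M) 1 := by
  induction t using List.reverseRecOn with
  | nil => simp [encode, wordSeries]
  | append_singleton t c ih =>
    have : (encode (t ++ [c])).reverse =
        List.replicate ((c.2 : ℕ) - 1) none ++ some c.1 :: (encode t).reverse := by
      simp [encode]
    rw [this, wordSeries_replicate_none, ih, List.map_append, List.foldl_append,
      Nat.sub_add_cancel c.2.pos]
    rfl

/-- Truncated polylogarithms of a shuffle product. -/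
theorem sum_mplTrunc_shuffleWords {A : Type*} {M : ℕ} (hM0 : 0 < M)
    (hM : ∀ n : ℕ, 0 < n → n < M → IsUnit (n : S)) (val : A → S) (t t' : List (A × ℕ+)) :
    ((shuffleWords (encode t).reverse (encode t').reverse).map fun w =>
      mplTrunc M ((decodeAux w.reverse).2.map fun c => (val c.1, (c.2 : ℕ)))).sum =
    coeff M (geomTail 1 * (t.map fun c => (val c.1, (c.2 : ℕ))).foldl (appendEntry M) 1 *
      (t'.map fun c => (val c.1, (c.2 : ℕ))).foldl (appendEntry M) 1) := by
  have h : ∀ t : List (A × ℕ+), (encode t).reverse.getLast? ≠ some none := fun t => by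
    rw [List.getLast?_reverse]; exact encode_head t
  rw [← wordSeries_encode, ← wordSeries_encode, mul_assoc, coeff_geomTail_mul]
  simp only [one_pow, one_mul]
  rw [sum_congr rfl fun n hn => (coeff_sum_wordSeries_shuffleWords hM val _ _ (h t) (h t') n
    (mem_range.1 hn)).symm]
  have : ∀ w ∈ shuffleWords (encode t).reverse (encode t').reverse,
      mplTrunc M ((decodeAux w.reverse).2.map fun c => (val c.1, (c.2 : ℕ))) =
        ∑ n ∈ range M, coeff n (wordSeries M val w) := by
    intro w hw
    have hl := (getLast?_shuffleWords _ _ (h t) (h t') w hw).1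
    rw [mplTrunc_eq_sum_coeff hM0, ← wordSeries_encode, encode_decodeAux_of_head,
      List.reverse_reverse]
    rwa [List.head?_reverse]
  rw [List.map_congr_left this]
  generalize shuffleWords (encode t).reverse (encode t').reverse = l
  induction l with
  | nil => simp
  | cons w l ih => simp only [List.map_cons, List.sum_cons, map_add, sum_add_distrib, ih]

end ShuffleSeries

end PShuffle

namespace PShuffle

open PowerSeries Finset

section Reversal

variable {S : Type*} [CommRing S]

/-- Weights can be moved from one factor of a product to the other one. -/
theorem coeff_mul_weightedMul (M : ℕ) (w : ℕ → S) (F K H : S⟦X⟧) :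
    coeff M (F * weightedMul w K H) =
      coeff M (weightedMul (fun i => w (M - i)) 1 F * (K * H)) := by
  rw [coeff_mul, coeff_mul]
  refine sum_congr rfl fun x hx => ?_
  have hx := mem_antidiagonal.1 hx
  rw [coeff_weightedMul, coeff_weightedMul, one_mul, show M - x.1 = x.2 by omega]
  ring

/-- The operator `appendEntry` with the weights reflected at `M`. -/
noncomputable def appendReflected (M : ℕ) (F : S⟦X⟧) (c : S × ℕ) : S⟦X⟧ :=
  weightedMul (fun n => truncInv S M (M - n) ^ c.2) (geomTail c.1) F

theorem coeff_geomTail_mul_foldl (M : ℕ) {s : ℕ} (u : Fin (s + 1) → S) (l : Fin s → ℕ)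
    (G : S⟦X⟧) :
    coeff M (geomTail (u (Fin.last s)) * G *
      (List.ofFn fun j => (u j.castSucc, l j)).foldl (appendEntry M) 1) =
    coeff M (geomTail (u 0) *
      (List.ofFn fun j => (u j.succ, l j)).foldr (fun c F => appendReflected M F c) G) := by
  induction s generalizing G with
  | zero => simp
  | succ s ih =>
    rw [List.ofFn_succ', List.concat_eq_append, List.foldl_append, List.foldl_cons,
      List.foldl_nil, List.ofFn_succ' (f := fun j => (u j.succ, l j)), List.concat_eq_append,
      List.foldr_append, List.foldr_cons, List.foldr_nil]
    have := ih (fun j => u j.castSucc) (fun j => l j.castSucc)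
      (appendReflected M G (u (Fin.last (s + 1)), l (Fin.last s)))
    simp only [Fin.succ_last, Fin.castSucc_zero, Fin.succ_castSucc] at this ⊢
    rw [← this, appendEntry, coeff_mul_weightedMul, ← mul_assoc]
    congr 2
    rw [mul_comm]
    congr 1
    ext n
    simp [appendReflected, coeff_weightedMul]

theorem weightedMul_sum {ι κ : Type*} (I : Finset ι) (J : Finset κ) (c : ι → S) (w : ι → ℕ → S)
    (d : κ → S) (K : S⟦X⟧) (F : κ → S⟦X⟧) :
    weightedMul (fun n => ∑ i ∈ I, c i * w i n) K (∑ j ∈ J, C (d j) * F j) =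
      ∑ i ∈ I, ∑ j ∈ J, C (c i * d j) * weightedMul (w i) K (F j) := by
  ext n
  simp only [coeff_weightedMul, mul_sum, map_sum, sum_mul, coeff_C_mul]
  rw [sum_comm]
  refine sum_congr rfl fun i _ => sum_congr rfl fun j _ => ?_
  rw [mul_left_comm K, coeff_C_mul]
  ring

theorem one_sub_pow_mul_sum_choose {t : S} {n : ℕ} (ht : t ^ n = 0) (l : ℕ) :
    (1 - t) ^ (l + 1) * ∑ f ∈ range n, ((l + f).choose f : S) * t ^ f = 1 := by
  induction l with
  | zero =>
    simp only [zero_add, pow_one, Nat.choose_self, Nat.cast_one, one_mul]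
    rw [mul_neg_geom_sum, ht, sub_zero]
  | succ l ih =>
    have key : ∀ m : ℕ, (1 - t) * ∑ f ∈ range m, ((l + 1 + f).choose f : S) * t ^ f =
        ∑ f ∈ range m, ((l + f).choose f : S) * t ^ f - ((l + m).choose (l + 1) : S) * t ^ m := by
      intro m
      induction m with
      | zero => simp
      | succ m ihm =>
        rw [sum_range_succ, mul_add, ihm, sum_range_succ]
        have e1 : (l + 1 + m).choose m = (l + m).choose l + (l + m).choose (l + 1) := by
          rw [Nat.choose_symm_of_eq_add (show l + 1 + m = m + (l + 1) by ring),
            show l + 1 + m = (l + m) + 1 by ring, Nat.choose_succ_succ]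
        have e2 : (l + (m + 1)).choose (l + 1) = (l + m).choose l + (l + m).choose (l + 1) := by
          rw [← Nat.choose_succ_succ]; rfl
        have e3 : (l + m).choose m = (l + m).choose l :=
          Nat.choose_symm_of_eq_add (by ring)
        rw [e1, e2, e3]
        push_cast
        ring
    rw [pow_succ, mul_assoc, key, ht, mul_zero, sub_zero, ih]

/-- The `M`-adic expansion of the reflected weights, when `M` is nilpotent. -/
theorem truncInv_sub_pow {M n : ℕ} (hM : ∀ i : ℕ, 0 < i → i < M → IsUnit (i : S))
    (hn : (M : S) ^ n = 0) (l i : ℕ) (hl : 0 < l) :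
    truncInv S M (M - i) ^ l = ∑ f ∈ range n,
      ((-1) ^ l * ((l + f - 1).choose f : S) * (M : S) ^ f) * truncInv S M i ^ (l + f) := by
  obtain ⟨l, rfl⟩ : ∃ l', l = l' + 1 := ⟨l - 1, by omega⟩
  have zero : truncInv S M (M - i) = 0 → truncInv S M i = 0 →
      truncInv S M (M - i) ^ (l + 1) = ∑ f ∈ range n,
      ((-1) ^ (l + 1) * ((l + 1 + f - 1).choose f : S) * (M : S) ^ f) *
        truncInv S M i ^ (l + 1 + f) := by
    intro h1 h2
    rw [h1, h2, zero_pow (by omega), sum_eq_zero]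
    intro f _
    rw [zero_pow (by omega), mul_zero]
  rcases Nat.eq_zero_or_pos i with rfl | hi
  · exact zero (truncInv_of_le (by omega)) (truncInv_zero M)
  rcases Nat.lt_or_ge i M with hiM | hiM
  · set u := truncInv S M i with hu
    set v := truncInv S M (M - i) with hv
    have h1 : (i : S) * u = 1 := mul_truncInv hiM (hM i hi hiM)
    have h2 : ((M : S) - i) * v = 1 := by
      rw [← Nat.cast_sub hiM.le]
      exact mul_truncInv (by omega) (hM _ (by omega) (by omega))
    have h3 : v * (1 - M * u) = -u := by linear_combination (-u) * h2 - v * h1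
    have h4 := one_sub_pow_mul_sum_choose (t := (M : S) * u) (n := n)
      (by rw [mul_pow, hn, zero_mul]) l
    calc v ^ (l + 1) = v ^ (l + 1) * ((1 - M * u) ^ (l + 1) *
          ∑ f ∈ range n, ((l + f).choose f : S) * (M * u) ^ f) := by rw [h4, mul_one]
      _ = (-u) ^ (l + 1) * ∑ f ∈ range n, ((l + f).choose f : S) * (M * u) ^ f := by
          rw [← mul_assoc, ← mul_pow, h3]
      _ = _ := by
          rw [mul_sum]
          refine sum_congr rfl fun f _ => ?_
          rw [show l + 1 + f - 1 = l + f by omega, neg_pow u]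
          ring
  · exact zero (by rw [Nat.sub_eq_zero_of_le hiM, truncInv_zero]) (truncInv_of_le hiM)

theorem foldr_appendReflected {M n : ℕ} (hM : ∀ i : ℕ, 0 < i → i < M → IsUnit (i : S))
    (hn : (M : S) ^ n = 0) {s : ℕ} (z : Fin s → S) (l : Fin s → ℕ) (hl : ∀ j, 0 < l j)
    (G : S⟦X⟧) :
    (List.ofFn fun j => (z j, l j)).foldr (fun c F => appendReflected M F c) G =
      ∑ f ∈ Fintype.piFinset fun _ : Fin s => range n,
        C (∏ j, ((-1) ^ l j * ((l j + f j - 1).choose (f j) : S) * (M : S) ^ f j)) *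
          (List.ofFn fun j => (z j, l j + f j)).foldr (fun c F => appendEntry M F c) G := by
  induction s with
  | zero => simp
  | succ s ih =>
    rw [List.ofFn_succ, List.foldr_cons, ih _ _ fun j => hl j.succ, appendReflected]
    simp only [truncInv_sub_pow hM hn _ _ (hl 0)]
    rw [weightedMul_sum (range n) _
      (fun f => (-1) ^ l 0 * ((l 0 + f - 1).choose f : S) * (M : S) ^ f)
      (fun f i => truncInv S M i ^ (l 0 + f)), ← sum_product']
    refine sum_equiv (Fin.consEquiv fun _ => ℕ) ?_ ?_
    · intro x
      simp [Fin.forall_fin_succ]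
    · intro x _
      simp [Fin.prod_univ_succ, List.ofFn_succ, appendEntry]

theorem rescale_appendEntry (M : ℕ) (c : S) (F : S⟦X⟧) (d : S × ℕ) :
    rescale c (appendEntry M F d) = appendEntry M (rescale c F) (d.1 * c, d.2) := by
  ext n
  simp only [appendEntry, coeff_rescale, coeff_weightedMul, coeff_geomTail_mul, mul_sum]
  refine sum_congr rfl fun m hm => ?_
  have hm := mem_range.1 hm
  rw [mul_pow]
  conv_lhs => rw [show n = (n - m) + m by omega, pow_add]
  rw [show n - m + m = n by omega]
  ring

theorem rescale_foldl_appendEntry (M : ℕ) (c : S) (t : List (S × ℕ)) (F : S⟦X⟧) :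
    rescale c (t.foldl (appendEntry M) F) =
      (t.map fun d => (d.1 * c, d.2)).foldl (appendEntry M) (rescale c F) := by
  induction t generalizing F with
  | nil => rfl
  | cons d t ih => rw [List.foldl_cons, ih, rescale_appendEntry, List.map_cons, List.foldl_cons]

theorem rescale_C_eq (c d : S) : rescale c (C d) = C d := by
  ext n
  rw [coeff_rescale, coeff_C]
  split_ifs with h <;> simp [h]

theorem coeff_geomTail_mul_eq_sum_rescale (M : ℕ) {a c : S} (h : a * c = 1) (F : S⟦X⟧) :
    coeff M (geomTail a * F) = a ^ M * ∑ m ∈ range M, coeff m (rescale c F) := by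
  rw [coeff_geomTail_mul, mul_sum]
  refine sum_congr rfl fun m hm => ?_
  have hm := mem_range.1 hm
  rw [coeff_rescale]
  conv_rhs => rw [show M = (M - m) + m by omega, pow_add]
  calc a ^ (M - m) * coeff m F = a ^ (M - m) * (a * c) ^ m * coeff m F := by
        rw [h, one_pow, mul_one]
    _ = _ := by rw [mul_pow]; ring

/-- The shuffle relation for truncated polylogarithms in a ring in which `M` is nilpotent. -/
theorem sum_mplTrunc_shuffleWords_eq {A : Type*} {M n : ℕ} (hM0 : 0 < M)
    (hM : ∀ i : ℕ, 0 < i → i < M → IsUnit (i : S)) (hn : (M : S) ^ n = 0) (val : A → S)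
    (t : List (A × ℕ+)) {s : ℕ} (y : Fin (s + 1) → A) (l : Fin (s + 1) → ℕ+) (c : S)
    (hc : val (y 0) * c = 1) :
    ((shuffleWords (encode t).reverse (encode (List.ofFn fun j => (y j, l j))).reverse).map
      fun w => mplTrunc M ((decodeAux w.reverse).2.map fun d => (val d.1, (d.2 : ℕ)))).sum =
    (-1) ^ (∑ j, (l j : ℕ)) * val (y 0) ^ M *
      ∑ f ∈ Fintype.piFinset fun _ : Fin (s + 1) => range n,
        ((∏ j, ((l j : ℕ) + f j - 1).choose (f j) : ℕ) : S) *
          mplTrunc M ((t.map fun d => (val d.1 * c, (d.2 : ℕ))) ++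
            (List.ofFn fun j =>
              (Fin.snoc (α := fun _ => S) (fun j : Fin s => val (y j.succ) * c) c j,
              (l j : ℕ) + f j)).reverse) * (M : S) ^ (∑ j, f j) := by
  rw [sum_mplTrunc_shuffleWords hM0 hM]
  have h1 := coeff_geomTail_mul_foldl M
    (Fin.snoc (α := fun _ => S) (fun j => val (y j)) 1) (fun j => (l j : ℕ))
    ((t.map fun d => (val d.1, (d.2 : ℕ))).foldl (appendEntry M) 1)
  have h0 : (Fin.snoc (α := fun _ => S) (fun j => val (y j)) 1 : Fin (s + 2) → S) 0 =
      val (y 0) := Fin.snoc_castSucc (α := fun _ => S) 1 (fun j => val (y j)) 0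
  rw [h0] at h1
  simp only [Fin.snoc_last, Fin.snoc_castSucc] at h1
  rw [List.map_ofFn]
  refine h1.trans ?_
  rw [coeff_geomTail_mul_eq_sum_rescale M hc, foldr_appendReflected hM hn _ _ fun j => (l j).pos]
  simp only [map_sum]
  rw [sum_comm, mul_comm ((-1) ^ _), mul_assoc, mul_sum _ _ ((-1 : S) ^ _)]
  congr 1
  refine sum_congr rfl fun f _ => ?_
  rw [mplTrunc_eq_sum_coeff hM0, List.foldl_append]
  have hz : ∀ j : Fin (s + 1), (Fin.snoc (α := fun _ => S) (fun j : Fin s => val (y j.succ) * c) c j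
      : S) = (Fin.snoc (α := fun _ => S) (fun j => val (y j)) 1 : Fin (s + 2) → S) j.succ * c := by
    intro j
    refine Fin.lastCases ?_ (fun j => ?_) j
    · rw [Fin.succ_last, Fin.snoc_last, Fin.snoc_last, one_mul]
    · rw [Fin.snoc_castSucc, Fin.succ_castSucc, Fin.snoc_castSucc]
  have hr : (rescale c) ((List.ofFn fun j => ((Fin.snoc (α := fun _ => S) (fun j => val (y j)) 1 :
        Fin (s + 2) → S) j.succ, (l j : ℕ) + f j)).foldr (fun c F => appendEntry M F c)
        ((t.map fun d => (val d.1, (d.2 : ℕ))).foldl (appendEntry M) 1)) =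
      (List.ofFn fun j => (Fin.snoc (α := fun _ => S) (fun j : Fin s => val (y j.succ) * c) c j,
        (l j : ℕ) + f j)).reverse.foldl (appendEntry M)
        ((t.map fun d => (val d.1 * c, (d.2 : ℕ))).foldl (appendEntry M) 1) := by
    rw [← List.foldl_reverse, rescale_foldl_appendEntry, rescale_foldl_appendEntry, List.map_map,
      map_one, List.map_reverse, List.map_ofFn]
    simp only [hz]
    rfl
  simp only [map_mul, rescale_C_eq, hr, coeff_C_mul, ← mul_sum]
  simp only [prod_mul_distrib, prod_pow_eq_pow_sum, Nat.cast_prod]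
  ring

end Reversal

end PShuffle

namespace PShuffle

open Finset

theorem map_ringInverse_of_isUnit {S T : Type*} [CommRing S] [CommRing T] (f : S →+* T) {x : S}
    (hx : IsUnit x) : f (Ring.inverse x) = Ring.inverse (f x) := by
  obtain ⟨u, rfl⟩ := hx
  rw [Ring.inverse_unit]
  exact (Ring.inverse_unit (Units.map (f : S →* T) u)).symm

theorem map_mplFrom {S T : Type*} [CommRing S] [CommRing T] (f : S →+* T) {M : ℕ}
    (hM : ∀ n : ℕ, 0 < n → n < M → IsUnit (n : S)) (m : ℕ) (t : List (S × ℕ)) :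
    f (mplFrom M m t) = mplFrom M m (t.map fun c => (f c.1, c.2)) := by
  induction t generalizing m with
  | nil => simp [mplFrom]
  | cons c t ih =>
    obtain ⟨a, k⟩ := c
    simp only [mplFrom, map_sum, List.map_cons]
    refine sum_congr rfl fun n hn => ?_
    rw [mem_Ioo] at hn
    rw [map_mul, map_mul, ih, map_pow,
      map_ringInverse_of_isUnit f ((hM n (by omega) hn.2).pow k), map_pow, map_natCast]

theorem isUnit_algebraMap_adicCompletion {R : Type*} [CommRing R] (I : Ideal R) (x : R)
    (h : ∀ k : ℕ, ∃ a, x * a - 1 ∈ I ^ k) : IsUnit (algebraMap R (AdicCompletion I R) x) := by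
  choose a ha using h
  have hcauchy : ∀ {m n : ℕ}, m ≤ n → a m ≡ a n [SMOD (I ^ m • ⊤ : Submodule R R)] := by
    intro m n hmn
    rw [SModEq.sub_mem, smul_eq_mul, Ideal.mul_top]
    have h1 := Ideal.mul_mem_left _ (a m) (Ideal.pow_le_pow_right hmn (ha n))
    have h2 := Ideal.mul_mem_left _ (a n) (ha m)
    have := Ideal.sub_mem _ h2 h1
    convert this using 1
    ring
  refine IsUnit.of_mul_eq_one (AdicCompletion.mk I R ⟨a, hcauchy⟩) ?_
  refine AdicCompletion.ext_evalₐ fun n => ?_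
  rw [map_mul, AlgHom.commutes, map_one, Ideal.Quotient.algebraMap_eq]
  refine (congrArg _ (AdicCompletion.evalₐ_mk I n _)).trans ?_
  rw [← map_mul, ← map_one (Ideal.Quotient.mk (I ^ n)), Ideal.Quotient.eq]
  exact ha n

theorem isUnit_natCast_adicCompletion (R : Type*) [CommRing R] {p : ℕ} (hp : p.Prime) (n : ℕ)
    (h0 : 0 < n) (hn : n < p) : IsUnit (n : AdicCompletion (Ideal.span {(p : R)}) R) := by
  rw [← map_natCast (algebraMap R _)]
  refine isUnit_algebraMap_adicCompletion _ _ fun k => ?_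
  have hc : IsCoprime (n : ℤ) ((p : ℤ) ^ k) := by
    have : Nat.Coprime n (p ^ k) :=
      (Nat.coprime_of_lt_prime h0.ne' hn hp).symm.pow_right k
    exact_mod_cast Nat.isCoprime_iff_coprime.2 this
  obtain ⟨a, b, hab⟩ := hc
  refine ⟨(a : R), ?_⟩
  have h1 := congrArg (Int.cast : ℤ → R) hab
  push_cast at h1
  have h2 : (n : R) * a - 1 = -(b * (p : R) ^ k) := by linear_combination h1
  change (n : R) * a - 1 ∈ Ideal.span {(p : R)} ^ k
  rw [h2, neg_mem_iff]
  exact Ideal.mul_mem_left _ _ (Ideal.pow_mem_pow (Ideal.mem_span_singleton_self _) k)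

section Level

variable {ι R : Type*} [CommRing R] (σ : ι → R)

/-- The projection of the adelic ring onto `𝒜ₙ`. -/
noncomputable def levelMap (n : ℕ+) : Adelic σ →+* AdelicLevel σ n :=
  (Pi.evalRingHom (fun n : ℕ+ => AdelicLevel σ n) n).comp (adelicSubring σ).subtype

/-- The projection of `∏ lim R/aⁿR` onto one of the factors `R/aⁿR`. -/
noncomputable def componentMap (n : ℕ) (i : ι) :
    (∀ i, AdicCompletion (Ideal.span {σ i}) R) →+* R ⧸ Ideal.span {σ i} ^ n :=
  (AdicCompletion.evalₐ (Ideal.span {σ i}) n).toRingHom.comp (Pi.evalRingHom _ i)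

theorem componentMap_apply (n : ℕ) (i : ι) (F : ∀ i, AdicCompletion (Ideal.span {σ i}) R) :
    componentMap σ n i F = AdicCompletion.evalₐ (Ideal.span {σ i}) n (F i) :=
  rfl

theorem levelMap_adelicProj_congr (n : ℕ+) {F G : ∀ i, AdicCompletion (Ideal.span {σ i}) R}
    (h : ∀ i, componentMap σ n i F = componentMap σ n i G) :
    levelMap σ n (adelicProj σ F) = levelMap σ n (adelicProj σ G) :=
  congrArg (Ideal.Quotient.mk (finSuppIdeal σ n)) (funext h)

theorem hasSum_of_levelMap {β : Type*} (g : β → Adelic σ) (z : Adelic σ)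
    (h : ∀ n : ℕ+, ∃ B : Finset β, ∀ b, B ⊆ b →
      levelMap σ n (∑ x ∈ b, g x) = levelMap σ n z) : HasSum g z := by
  let _ : ∀ n : ℕ+, TopologicalSpace (AdelicLevel σ n) := fun _ => ⊥
  have _ : ∀ n : ℕ+, DiscreteTopology (AdelicLevel σ n) := fun _ => ⟨rfl⟩
  have hi : Topology.IsInducing (fun f : Adelic σ => (f.1 : ∀ n : ℕ+, AdelicLevel σ n)) := ⟨rfl⟩
  rw [HasSum, SummationFilter.unconditional_filter, hi.tendsto_nhds_iff, tendsto_pi_nhds]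
  intro n
  obtain ⟨B, hB⟩ := h n
  refine tendsto_nhds_of_eventually_eq ?_
  filter_upwards [Filter.eventually_ge_atTop B] with b hb
  exact hB b hb

instance : T2Space (Adelic σ) := by
  let _ : ∀ n : ℕ+, TopologicalSpace (AdelicLevel σ n) := fun _ => ⊥
  have _ : ∀ n : ℕ+, DiscreteTopology (AdelicLevel σ n) := fun _ => ⟨rfl⟩
  have hi : Topology.IsEmbedding (fun f : Adelic σ => (f.1 : ∀ n : ℕ+, AdelicLevel σ n)) :=
    ⟨⟨rfl⟩, Subtype.val_injective⟩
  exact hi.t2Space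

end Level

theorem tupleShuffle_single {A : Type*} (t t' : List (A × ℕ+)) :
    tupleShuffle (Finsupp.single t 1) (Finsupp.single t' 1) =
      ((shuffleWords (encode t).reverse (encode t').reverse).map fun w =>
        (Finsupp.single (decodeAux w.reverse).2 1 : Tuples A)).sum := by
  rw [tupleShuffle, W_single, W_single, shuffle_basis, shuffleRev_eq_sum, map_list_sum,
    List.map_map]
  congr 1
  refine List.map_congr_left fun w _ => ?_
  simp [WInv]

section FMPL

variable (N : ℕ) (α : ZMod N) {R : Type*} [CommRing R]

theorem fmplLin_tupleShuffle_single {A : Type*} (val : A → R) (t t' : List (A × ℕ+)) :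
    fmplLin N α val (tupleShuffle (Finsupp.single t 1) (Finsupp.single t' 1)) =
      ((shuffleWords (encode t).reverse (encode t').reverse).map fun w =>
        fmpl N α ((decodeAux w.reverse).2.map fun c => (val c.1, (c.2 : ℕ)))).sum := by
  rw [tupleShuffle_single, map_list_sum, List.map_map]
  congr 1
  refine List.map_congr_left fun w _ => ?_
  simp [fmplLin, Finsupp.linearCombination_single]

theorem evalₐ_mplTrunc (p : PrimesMod N α) (n : ℕ) (t : List (R × ℕ)) :
    AdicCompletion.evalₐ (Ideal.span {((p : ℕ) : R)}) n
      (mplTrunc (p : ℕ) (t.map fun c => (algebraMap R (AdicCompletion _ R) c.1, c.2))) =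
    mplTrunc (p : ℕ) (t.map fun c =>
      (Ideal.Quotient.mk (Ideal.span {((p : ℕ) : R)} ^ n) c.1, c.2)) := by
  have := map_mplFrom (AdicCompletion.evalₐ (Ideal.span {((p : ℕ) : R)}) n).toRingHom
    (isUnit_natCast_adicCompletion R p.2.1) 0
    (t.map fun c => (algebraMap R (AdicCompletion _ R) c.1, c.2))
  rw [List.map_map] at this
  refine this.trans ?_
  rw [mplTrunc]
  congr 1

theorem isUnit_natCast_quotient (p : PrimesMod N α) (n i : ℕ) (h0 : 0 < i) (hi : i < p) :
    IsUnit (i : R ⧸ Ideal.span {((p : ℕ) : R)} ^ n) := by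
  rw [← map_natCast (AdicCompletion.evalₐ (Ideal.span {((p : ℕ) : R)}) n)]
  exact (isUnit_natCast_adicCompletion R p.2.1 i h0 hi).map _

theorem natCast_pow_quotient (p : PrimesMod N α) (n : ℕ) :
    ((p : ℕ) : R ⧸ Ideal.span {((p : ℕ) : R)} ^ n) ^ n = 0 := by
  rw [← map_natCast (Ideal.Quotient.mk (Ideal.span {((p : ℕ) : R)} ^ n)), ← map_pow,
    Ideal.Quotient.eq_zero_iff_mem]
  exact Ideal.pow_mem_pow (Ideal.mem_span_singleton_self _) n

theorem levelMap_bigP_pow (n : ℕ+) (m : ℕ) (h : (n : ℕ) ≤ m) :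
    levelMap _ n (bigP N α R ^ m) = 0 := by
  rw [bigP, ← map_pow, ← map_zero (levelMap _ n), ← map_zero (adelicProj _)]
  refine levelMap_adelicProj_congr _ n fun p => ?_
  rw [map_pow, componentMap_apply, map_natCast, map_zero]
  exact pow_eq_zero_of_le h (natCast_pow_quotient N α p n)

theorem powP_mul_powP {a b : R} (h : a * b = 1) : powP N α a * powP N α b = 1 := by
  rw [powP, powP, ← map_mul, ← map_one (adelicProj _)]
  congr 1
  funext p
  rw [Pi.mul_apply, ← mul_pow, ← map_mul, h, map_one, one_pow, Pi.one_apply]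

/-- The tuple obtained from `t` and `(y₁, …, y_{s+1}; l₁, …, l_{s+1})` by reversing the second one
and dividing by `y₁`, the inverse of `y₁` being `c`. -/
noncomputable def reversedList {A : Type*} (val : A → R) (t : List (A × ℕ+)) {s : ℕ}
    (y : Fin (s + 1) → A) (l : Fin (s + 1) → ℕ+) (c : R) (f : Fin (s + 1) → ℕ) : List (R × ℕ) :=
  (t.map fun d => (val d.1 * c, (d.2 : ℕ))) ++
    (List.ofFn fun j => (Fin.snoc (α := fun _ => R) (fun j : Fin s => val (y j.succ) * c) c j,
      (l j : ℕ) + f j)).reverse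

theorem map_reversedList {S : Type*} [CommRing S] (φ : R →+* S) {A : Type*} (val : A → R)
    (t : List (A × ℕ+)) {s : ℕ} (y : Fin (s + 1) → A) (l : Fin (s + 1) → ℕ+) (c : R)
    (f : Fin (s + 1) → ℕ) :
    (reversedList val t y l c f).map (fun d => (φ d.1, d.2)) =
      reversedList (fun a => φ (val a)) t y l (φ c) f := by
  have h : ∀ j : Fin (s + 1),
      φ (Fin.snoc (α := fun _ => R) (fun j : Fin s => val (y j.succ) * c) c j) =
        Fin.snoc (α := fun _ => S) (fun j : Fin s => φ (val (y j.succ)) * φ c) (φ c) j := by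
    intro j
    refine Fin.lastCases ?_ (fun j => ?_) j
    · rw [Fin.snoc_last, Fin.snoc_last]
    · rw [Fin.snoc_castSucc, Fin.snoc_castSucc, map_mul]
  simp only [reversedList, List.map_append, List.map_map, List.map_reverse, List.map_ofFn]
  congr 1
  · refine List.map_congr_left fun d _ => ?_
    simp
  · congr 2
    funext j
    simp only [Function.comp_apply, h]

/-- The shuffle relation in `𝒜ₙ`. -/
theorem levelMap_fmplLin_tupleShuffle (n : ℕ+) {A : Type*} (val : A → R) (t : List (A × ℕ+))
    {s : ℕ} (y : Fin (s + 1) → A) (l : Fin (s + 1) → ℕ+) (c : R) (hc : val (y 0) * c = 1) :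
    levelMap _ n (fmplLin N α val (tupleShuffle (Finsupp.single t 1)
      (Finsupp.single (List.ofFn fun j => (y j, l j)) 1))) =
    levelMap _ n ((-1) ^ (∑ j, (l j : ℕ)) * powP N α (val (y 0)) *
      ∑ f ∈ Fintype.piFinset fun _ : Fin (s + 1) => range n,
        ((∏ j, ((l j : ℕ) + f j - 1).choose (f j) : ℕ) : AHat N α R) *
          fmpl N α (reversedList val t y l c f) * bigP N α R ^ (∑ j, f j)) := by
  rw [fmplLin_tupleShuffle_single]
  simp only [fmpl, powP, bigP]
  rw [← map_one (adelicProj fun p : PrimesMod N α => ((p : ℕ) : R))]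
  simp only [← map_neg, ← map_pow, ← map_mul,
    ← map_natCast (adelicProj fun p : PrimesMod N α => ((p : ℕ) : R)), ← map_sum]
  rw [← Function.comp_def (adelicProj fun p : PrimesMod N α => ((p : ℕ) : R)),
    ← List.map_map, ← map_list_sum]
  refine levelMap_adelicProj_congr _ n fun p => ?_
  have key := sum_mplTrunc_shuffleWords_eq p.2.1.pos (isUnit_natCast_quotient (R := R) N α p n)
    (natCast_pow_quotient N α p n)
    (fun a => Ideal.Quotient.mk (Ideal.span {((p : ℕ) : R)} ^ (n : ℕ)) (val a)) t y l
    (Ideal.Quotient.mk _ c) (by rw [← map_mul, hc, map_one])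
  set Φ := componentMap (fun p : PrimesMod N α => ((p : ℕ) : R)) n p
  have hΦ : ∀ t : List (R × ℕ), Φ (fun q => mplTrunc (q : ℕ)
      (t.map fun c => (algebraMap R (AdicCompletion _ R) c.1, c.2))) =
      mplTrunc (p : ℕ) (t.map fun c =>
        (Ideal.Quotient.mk (Ideal.span {((p : ℕ) : R)} ^ (n : ℕ)) c.1, c.2)) :=
    evalₐ_mplTrunc N α p n
  have hy : Φ (fun q => algebraMap R (AdicCompletion _ R) (val (y 0)) ^ (q : ℕ)) =
      Ideal.Quotient.mk (Ideal.span {((p : ℕ) : R)} ^ (n : ℕ)) (val (y 0)) ^ (p : ℕ) := by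
    change AdicCompletion.evalₐ _ _ (_ ^ (p : ℕ)) = _
    rw [map_pow, AlgHom.commutes, Ideal.Quotient.algebraMap_eq]
  have hp : Φ (fun q => ((q : ℕ) : AdicCompletion _ R)) = ((p : ℕ) : R ⧸ _) :=
    map_natCast (AdicCompletion.evalₐ (Ideal.span {((p : ℕ) : R)}) n) p
  simp only [map_mul, map_sum, map_neg, map_pow, map_natCast, map_one, map_list_sum,
    List.map_map (g := Φ), Function.comp_def, hΦ, hy, hp]
  simp only [map_reversedList, List.map_map, Function.comp_def]
  exact key

/-- The shuffle relation for `𝐩`-adic finite multiple polylogarithms. -/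
theorem hasSum_fmpl_reversedList {A : Type*} (val : A → R) (t : List (A × ℕ+))
    {s : ℕ} (y : Fin (s + 1) → A) (l : Fin (s + 1) → ℕ+) (c : R) (hc : val (y 0) * c = 1) :
    HasSum (fun f : Fin (s + 1) → ℕ =>
      ((∏ j, ((l j : ℕ) + f j - 1).choose (f j) : ℕ) : AHat N α R) *
        fmpl N α (reversedList val t y l c f) * bigP N α R ^ (∑ j, f j))
    ((-1) ^ (∑ j, (l j : ℕ)) * powP N α c *
      fmplLin N α val (tupleShuffle (Finsupp.single t 1)
        (Finsupp.single (List.ofFn fun j => (y j, l j)) 1))) := by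
  refine hasSum_of_levelMap _ _ _ fun n =>
    ⟨Fintype.piFinset fun _ : Fin (s + 1) => range n, fun b hb => ?_⟩
  rw [map_mul _ _ (fmplLin N α val _), levelMap_fmplLin_tupleShuffle N α n val t y l c hc,
    ← map_mul, ← mul_assoc, mul_mul_mul_comm, ← mul_pow, neg_one_mul, neg_neg, one_pow, one_mul,
    mul_comm (powP N α c), powP_mul_powP N α hc, one_mul, map_sum, map_sum]
  refine (sum_subset hb fun f _ hf => ?_).symm
  rw [map_mul, levelMap_bigP_pow, mul_zero]
  simp only [Fintype.mem_piFinset, mem_range, not_forall, not_lt] at hf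
  obtain ⟨j, hj⟩ := hf
  exact hj.trans (single_le_sum (f := f) (fun _ _ => Nat.zero_le _) (mem_univ j))

end FMPL

theorem yv_mul_y1inv {r s : ℕ} : (yv 0 : LaurentRing r s) * y1inv = 1 :=
  IsLocalization.Away.mul_invSelf _

theorem reversedTuple_eq {r s : ℕ} (k : Fin r → ℕ+) (l : Fin (s + 1) → ℕ+)
    (f : Fin (s + 1) → ℕ) :
    reversedTuple k l f = reversedList (symbVal (r := r) (s := s))
      (List.ofFn fun i => (some (Sum.inl i), k i)) (fun j => some (Sum.inr j)) l y1inv f := by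
  have zip_ofFn : ∀ {β γ : Type} {m : ℕ} (a : Fin m → β) (b : Fin m → γ),
      List.zip (List.ofFn a) (List.ofFn b) = List.ofFn fun i => (a i, b i) := by
    intro β γ m a b
    refine List.ext_getElem (by simp) fun i h1 h2 => ?_
    simp
  have h : y1inv :: (List.ofFn fun j : Fin s => (yv j.succ * y1inv : LaurentRing r s)).reverse =
      (List.ofFn fun j => Fin.snoc (α := fun _ => LaurentRing r s)
        (fun j : Fin s => yv j.succ * y1inv) y1inv j).reverse := by
    rw [List.ofFn_succ', List.concat_eq_append, List.reverse_append]
    simp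
  rw [reversedTuple, reversedList, h, List.zip_append (by simp), zip_ofFn, List.map_ofFn]
  congr 1
  rw [List.zip, ← List.reverse_zipWith (by simp)]
  congr 1
  exact zip_ofFn _ _

end PShuffle

theorem mainTheorem1 (N : ℕ) [NeZero N] (α : ZMod N) (r s : ℕ)
    (k : Fin r → ℕ+) (l : Fin (s + 1) → ℕ+) :
    Summable (fun f : Fin (s + 1) → ℕ =>
      ((∏ j, ((l j : ℕ) + f j - 1).choose (f j) : ℕ) : AHat N α (LaurentRing r s)) *
        fmpl N α (reversedTuple k l f) * bigP N α (LaurentRing r s) ^ (∑ j, f j)) ∧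
    fmplLin N α symbVal (tupleShuffle (xTuple k) (yTuple l)) =
      (-1) ^ (∑ j, (l j : ℕ)) * powP N α (yv (r := r) (s := s) 0) *
        ∑' f : Fin (s + 1) → ℕ,
          ((∏ j, ((l j : ℕ) + f j - 1).choose (f j) : ℕ) : AHat N α (LaurentRing r s)) *
            fmpl N α (reversedTuple k l f) * bigP N α (LaurentRing r s) ^ (∑ j, f j) := by
  have h := hasSum_fmpl_reversedList N α (symbVal (r := r) (s := s))
    (List.ofFn fun i => (some (Sum.inl i), k i)) (fun j => some (Sum.inr j)) l y1inv yv_mul_y1inv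
  simp only [← reversedTuple_eq] at h
  refine ⟨h.summable, ?_⟩
  rw [h.tsum_eq, ← mul_assoc, mul_mul_mul_comm, ← mul_pow, neg_one_mul, neg_neg, one_pow, one_mul,
    powP_mul_powP N α yv_mul_y1inv, one_mul]
  rfl
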